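/- Let $\vec D$ be an oriented link diagram on the sphere (or plane) that is connected (as a 4-valent graph; a single circle without crossings is allowed) and alternating. Let $w(\vec D)$ be its writhe, i.e. the sum of the signs of its crossings. Let $|D_{s_+}|$ (resp. $|D_{s_-}|$) be the number of circles obtained by smoothing every crossing with the positive (resp. negative) Kauffman marker, where the positive smoothing merges the two regions swept out by the overstrand when it is rotated counterclockwise towards the understrand, and the negative smoothing is the other one. Let $\Gamma(\vec D)$ be the Seifert graph: the signed multigraph whose vertices are the Seifert circles (the circles obtained by smoothing every crossing according to the orientation) and whose edges are the crossings, each edge joining the Seifert circles that meet at its crossing and carrying the sign of the crossing. For a spanning tree $T$ of $\Gamma(\vec D)$ let $d_+(T)$ and $d_-(T)$ be the numbers of positive and negative edges of $T$. Then $\Gamma(\vec D)$ has a spanning tree, the numbers $d_+(\vec D)=d_+(T)$ and $d_-(\vec D)=d_-(T)$ do not depend on the choice of the spanning tree $T$, and $$\tfrac12\bigl(w(\vec D)+|D_{s_+}|-|D_{s_-}|\bigr)=d_+(\vec D)-d_-(\vec D).$$ In particular, if $p$ is a non-nugatory crossing and $\vec D^p_0$ is the diagram obtained from $\vec D$ by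 smoothing $p$ according to the orientation, then $$\tfrac12\bigl(w(\vec D^p_0)+|(D^p_0)_{s_+}|-|(D^p_0)_{s_-}|\bigr)=\tfrac12\bigl(w(\vec D)+|D_{s_+}|-|D_{s_-}|\bigr).$$ Here $p$ is called nugatory if $\vec D^p_0$ has more connected components (as a graph) than $\vec D$. -/

import Mathlib

/-! Oriented link diagrams on the oriented sphere, presented as combinatorial maps (rotation systems
with crossing data, as in planar diagram codes). -/

/-- The ends of edges ("darts") of a diagram with set of crossings `C` and set of marked points `P`.
A crossing has four ends, numbered counterclockwise by `ZMod 4`; the ends `0`, `2` lie on the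
understrand and `1`, `3` on the overstrand. A marked point is a bivalent vertex in the interior of
an arc (it has no further meaning; it allows components without crossings), with two ends. -/
abbrev Dart (C P : Type*) := (C × ZMod 4) ⊕ (P × Bool)

namespace Dart

variable {C P : Type*}

/-- The vertex (crossing or marked point) at which a dart sits. -/
def vertex : Dart C P → C ⊕ P
  | .inl (c, _) => .inl c
  | .inr (x, _) => .inr x

/-- The next dart counterclockwise around the same vertex. -/
def rot : Dart C P → Dart C P
  | .inl (c, i) => .inl (c, i + 1)
  | .inr (x, b) => .inr (x, !b)

/-- The dart on the other side of the vertex, on the same strand of the link. -/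
def through : Dart C P → Dart C P
  | .inl (c, i) => .inl (c, i + 2)
  | .inr (x, b) => .inr (x, !b)

end Dart

/-- The ends of the overstrand at a crossing. -/
def IsOver (i : ZMod 4) : Prop := i = 1 ∨ i = 3

instance (i : ZMod 4) : Decidable (IsOver i) := inferInstanceAs (Decidable (_ ∨ _))

/-- The smoothing of a crossing with marker `m = ±1`: the end to which the end `i` gets joined.
The positive marker lies in the two regions swept by the overstrand when it is rotated
counterclockwise, and these are merged: ends are joined `0 ↔ 1`, `2 ↔ 3`.
The negative marker joins `1 ↔ 2`, `3 ↔ 0`. -/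
def partner (m : ℤˣ) (i : ZMod 4) : ZMod 4 :=
  if IsOver i then i - ((m : ℤ) : ZMod 4) else i + ((m : ℤ) : ZMod 4)

/-- An oriented link diagram on a closed oriented surface; the diagrams on the sphere (or plane) are
those with `IsPlanar` below. `opp` exchanges the two ends of each edge, and `out d` tells whether
the orientation points away from the vertex at the dart `d`. -/
structure OrientedDiagram (C P : Type*) where
  opp : Dart C P → Dart C P
  opp_opp : ∀ d, opp (opp d) = d
  opp_ne : ∀ d, opp d ≠ d
  out : Dart C P → Bool
  out_opp : ∀ d, out (opp d) = !out d
  out_through : ∀ d, out d.through = !out d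

namespace OrientedDiagram

variable {C P : Type*} (D : OrientedDiagram C P)

/-- The connected components of the underlying graph of the diagram. -/
def Component : Type _ :=
  Quot fun d e : Dart C P => e = D.opp d ∨ e.vertex = d.vertex

/-- The diagram is connected (as a graph; in particular non-empty). -/
def IsConnected : Prop := Nat.card D.Component = 1

/-- The faces of the combinatorial map: the orbits of "go along the edge, then turn to the next
dart". -/
def Face : Type _ :=
  Quot fun d e : Dart C P => e = (D.opp d).rot

/-- The surface has genus zero: `V - E + F = 2 · #components`, where `V = |C| + |P|` and
`E = 2 |C| + |P|`. -/
def IsPlanar : Prop :=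
  ((Nat.card C + Nat.card P : ℕ) : ℤ) - ((2 * Nat.card C + Nat.card P : ℕ) : ℤ) + Nat.card D.Face
    = 2 * Nat.card D.Component

/-- Two darts lie on the same arc of the diagram between consecutive crossings: one gets from one to
the other along edges and across marked points, without passing a crossing. -/
def SameArc : Dart C P → Dart C P → Prop :=
  Relation.EqvGen fun d e => e = D.opp d ∨ ∃ x b, d = .inr (x, b) ∧ e = .inr (x, !b)

/-- Overcrossings and undercrossings alternate along every link component: of the two ends of an
arc that joins crossings one is over and the other is under. -/
def IsAlternating : Prop :=
  ∀ d e : C × ZMod 4, d ≠ e → D.SameArc (.inl d) (.inl e) → (IsOver e.2 ↔ ¬ IsOver d.2)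

/-- The sign of a crossing: positive if the direction of the understrand is obtained from the
direction of the overstrand by a counterclockwise quarter turn. -/
def sign (c : C) : ℤˣ := if D.out (.inl (c, 1)) = D.out (.inl (c, 2)) then 1 else -1

/-- The writhe. -/
def writhe [Fintype C] : ℤ := ∑ c, (D.sign c : ℤ)

/-- After smoothing all crossings by the state `s`, the dart that gets joined to a given dart at its
vertex. -/
def join (s : C → ℤˣ) : Dart C P → Dart C P
  | .inl (c, i) => .inl (c, partner (s c) i)
  | .inr (x, b) => .inr (x, !b)

/-- The circles of `D_s`, for a Kauffman state `s`. -/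
def Circle (s : C → ℤˣ) : Type _ :=
  Quot fun d e : Dart C P => e = D.opp d ∨ e = join s d

/-- The number `|D_s|` of circles. -/
noncomputable def numCircles (s : C → ℤˣ) : ℕ := Nat.card (D.Circle s)

/-- The circle of `D_s` through a dart. -/
def circleOf (s : C → ℤˣ) (d : Dart C P) : D.Circle s := Quot.mk _ d

/-- The graph `G_s(D)`: vertices are the circles of `D_s`, edges are the crossings; a crossing links
the circles through the two arcs of its smoothing. (The ends `0` and `2` lie on different arcs for
either marker.) -/
def stateGraph (s : C → ℤˣ) : Graph (D.Circle s) C where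
  vertexSet := Set.univ
  IsLink c x y :=
    (x = D.circleOf s (.inl (c, 0)) ∧ y = D.circleOf s (.inl (c, 2))) ∨
    (x = D.circleOf s (.inl (c, 2)) ∧ y = D.circleOf s (.inl (c, 0)))
  isLink_symm := fun _ _ =>
    ⟨fun _ _ h => h.elim (fun h => .inr ⟨h.2, h.1⟩) fun h => .inl ⟨h.2, h.1⟩⟩
  eq_or_eq_of_isLink_of_isLink := by grind
  left_mem_of_isLink := fun _ _ _ _ => Set.mem_univ _

/-- The state given by the orientation: its marker at `c` joins incoming to outgoing ends. -/
def seifertState (c : C) : ℤˣ := if D.out (.inl (c, 0)) ≠ D.out (.inl (c, 1)) then 1 else -1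

/-- The Seifert graph; the sign of the edge `c` is `D.sign c`. -/
def seifertGraph : Graph (D.Circle D.seifertState) C := D.stateGraph D.seifertState

/-- The number of positive edges of a subgraph of the Seifert graph. -/
noncomputable def dPlus (T : Graph (D.Circle D.seifertState) C) : ℕ :=
  {c ∈ T.edgeSet | D.sign c = 1}.ncard

/-- The number of negative edges of a subgraph of the Seifert graph. -/
noncomputable def dMinus (T : Graph (D.Circle D.seifertState) C) : ℕ :=
  {c ∈ T.edgeSet | D.sign c = -1}.ncard

theorem out_partner (c : C) (i : ZMod 4) :
    D.out (.inl (c, partner (D.seifertState c) i)) = !D.out (.inl (c, i)) := by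
  have h0 : D.out (.inl (c, 2)) = !D.out (.inl (c, 0)) := D.out_through (.inl (c, 0))
  have h1 : D.out (.inl (c, 3)) = !D.out (.inl (c, 1)) := D.out_through (.inl (c, 1))
  have e : ∀ i : ZMod 4, (partner 1 i = if i = 0 then 1 else if i = 1 then 0 else
      if i = 2 then 3 else 2) ∧ (partner (-1) i = if i = 0 then 3 else if i = 1 then 2 else
      if i = 2 then 1 else 0) := by decide
  have hi : i = 0 ∨ i = 1 ∨ i = 2 ∨ i = 3 := by revert i; decide
  unfold seifertState
  split_ifs with h
  · rw [(e i).1]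
    rcases hi with rfl | rfl | rfl | rfl <;> revert h h0 h1 <;>
      simp +decide <;> grind
  · rw [(e i).2]
    rcases hi with rfl | rfl | rfl | rfl <;> revert h h0 h1 <;>
      simp +decide <;> grind

variable [DecidableEq C]

/-- Smoothing the crossing `p` with marker `m` replaces it by two marked points, `false` on the arc
through the end `0` and `true` on the arc through the end `2`. This map sends each dart of the
smoothed diagram to the dart of the original diagram that it comes from. -/
def unsmooth (p : C) (m : ℤˣ) : Dart {c : C // c ≠ p} (P ⊕ Bool) → Dart C P
  | .inl (c, i) => .inl (c.1, i)
  | .inr (.inl x, b) => .inr (x, b)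
  | .inr (.inr false, false) => .inl (p, 0)
  | .inr (.inr false, true) => .inl (p, partner m 0)
  | .inr (.inr true, false) => .inl (p, 2)
  | .inr (.inr true, true) => .inl (p, partner m 2)

/-- The inverse of `unsmooth`. -/
def resmooth (p : C) (m : ℤˣ) : Dart C P → Dart {c : C // c ≠ p} (P ⊕ Bool)
  | .inr (x, b) => .inr (.inl x, b)
  | .inl (c, i) =>
    if h : c = p then
      if i = 0 then .inr (.inr false, false)
      else if i = partner m 0 then .inr (.inr false, true)
      else if i = 2 then .inr (.inr true, false)
      else .inr (.inr true, true)
    else .inl (⟨c, h⟩, i)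

theorem resmooth_unsmooth (p : C) (m : ℤˣ) (d : Dart {c : C // c ≠ p} (P ⊕ Bool)) :
    resmooth p m (unsmooth p m d) = d := by
  have e : ∀ m : ℤˣ, partner m 0 ≠ 0 ∧ partner m 0 ≠ 2 ∧ partner m 2 ≠ 0 ∧ partner m 2 ≠ 2 ∧
    partner m 2 ≠ partner m 0 ∧ (2 : ZMod 4) ≠ 0 := by decide
  obtain ⟨h1, h2, h3, h4, h5, h6⟩ := e m
  rcases d with ⟨⟨c, hc⟩, i⟩ | ⟨x | (_ | _), (_ | _)⟩ <;>
    simp [unsmooth, resmooth, h2.symm, *]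

theorem unsmooth_resmooth (p : C) (m : ℤˣ) (d : Dart C P) :
    unsmooth p m (resmooth p m d) = d := by
  have e : ∀ (m : ℤˣ) (i : ZMod 4), i = 0 ∨ i = partner m 0 ∨ i = 2 ∨ i = partner m 2 := by decide
  rcases d with ⟨c, i⟩ | ⟨x, b⟩
  · by_cases h : c = p
    · subst h
      have := e m i
      simp only [resmooth, dif_pos]
      split_ifs <;> simp [unsmooth] <;> grind
    · simp [resmooth, h, unsmooth]
  · simp [resmooth, unsmooth]

/-- The oriented diagram obtained by smoothing the crossing `p` according to the orientation. All
other crossings, all edges and all directions are kept. -/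
def smooth (p : C) : OrientedDiagram {c : C // c ≠ p} (P ⊕ Bool) where
  opp d := resmooth p (D.seifertState p) (D.opp (unsmooth p (D.seifertState p) d))
  opp_opp d := by rw [unsmooth_resmooth, D.opp_opp, resmooth_unsmooth]
  opp_ne d h := D.opp_ne (unsmooth p (D.seifertState p) d) <| by
    conv_rhs => rw [← h]
    rw [unsmooth_resmooth]
  out d := D.out (unsmooth p (D.seifertState p) d)
  out_opp d := by rw [unsmooth_resmooth, D.out_opp]
  out_through d := by
    have h0 := D.out_partner p 0
    have h2 := D.out_partner p 2
    rcases d with ⟨⟨c, hc⟩, i⟩ | ⟨x | (_ | _), (_ | _)⟩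
    · exact D.out_through (.inl (c, i))
    · exact D.out_through (.inr (x, false))
    · exact D.out_through (.inr (x, true))
    all_goals simp [Dart.through, unsmooth, h0, h2]

/-- A crossing is nugatory if smoothing it along the orientation gives a diagram with more
(graph) components. -/
def IsNugatory (p : C) : Prop := Nat.card D.Component < Nat.card (D.smooth p).Component

end OrientedDiagram

/-- A multigraph is a tree: it is non-empty, connected, and no edge lies on a cycle, i.e. the ends
of an edge are not connected after deleting this edge (in particular there are no loops). -/
structure Graph.IsTree {V E : Type*} (T : Graph V E) : Prop where
  nonempty : T.vertexSet.Nonempty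
  connected : ∀ x ∈ T.vertexSet, ∀ y ∈ T.vertexSet, Relation.EqvGen T.Adj x y
  acyclic : ∀ e x y, T.IsLink e x y → ¬ Relation.EqvGen (T.deleteEdges {e}).Adj x y

/-- `T` is a spanning tree of the multigraph `G`. -/
def Graph.IsSpanningTree {V E : Type*} (T G : Graph V E) : Prop :=
  T.IsSpanningSubgraph G ∧ T.IsTree

/-! The proof squeezes `|D_{s_+}| + |D_{s_-}|` between two bounds. Let `n` be the number of
crossings and `n_±` the numbers of positive and negative ones.

Upper bound, valid for every diagram (`numCircles_flip_add_le`): if the markers in `A` are changed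
in a state `s`, the old and new circles number at most `2k(A) + |A|` together, where `k(A)` counts
the components of the edges `A` in the state graph. The Seifert marker of a crossing is its sign, so
changing the markers at the negative crossings gives `s_+`. Discarding the edges outside a spanning
tree `T` only raises `k`, whence `|D_{s_+}| + 2d_-(T) ≤ |D_s| + n_-`, and symmetrically for `s_-`.
As `T` has `|D_s| - 1` edges, these add up to `|D_{s_+}| + |D_{s_-}| ≤ n + 2`.

Lower bound (`add_two_le_numCircles`): in an alternating diagram the circles of the two extreme
states cover all faces, of which Euler's formula gives `n + 2`.

Hence both inequalities for `T` are equalities, and their difference is the formula. For the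
smoothed diagram the upper bound alone suffices, so it need not be shown planar or alternating. -/

/-! ### Counting the classes of a relation -/

section Classes

variable {α β : Type*}

theorem Nat.card_quot_le_of_le [Finite α] {r r' : α → α → Prop}
    (h : ∀ x y, r x y → Relation.EqvGen r' x y) : Nat.card (Quot r') ≤ Nat.card (Quot r) := by
  refine Nat.card_le_card_of_surjective
    (Quot.lift (fun x => Quot.mk r' x) fun x y hxy => Quot.eqvGen_sound (h x y hxy)) ?_
  rintro ⟨x⟩
  exact ⟨Quot.mk r x, rfl⟩

theorem Nat.card_quot_congr [Finite α] {r r' : α → α → Prop}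
    (h : ∀ x y, r x y → Relation.EqvGen r' x y) (h' : ∀ x y, r' x y → Relation.EqvGen r x y) :
    Nat.card (Quot r) = Nat.card (Quot r') :=
  (card_quot_le_of_le h').antisymm (card_quot_le_of_le h)

/-- The relation `r` with the additional pair `(a, b)`. -/
def addPair (r : α → α → Prop) (a b x y : α) : Prop := r x y ∨ (x = a ∧ y = b)

theorem card_quot_addPair_of_eqvGen [Finite α] {r : α → α → Prop} {a b : α}
    (h : Relation.EqvGen r a b) : Nat.card (Quot (addPair r a b)) = Nat.card (Quot r) := by
  refine Nat.card_quot_congr ?_ fun x y hxy => .rel _ _ (.inl hxy)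
  rintro x y (hxy | ⟨rfl, rfl⟩)
  exacts [.rel _ _ hxy, h]

theorem card_quot_addPair_of_not_eqvGen [Finite α] {r : α → α → Prop} {a b : α}
    (h : ¬ Relation.EqvGen r a b) : Nat.card (Quot (addPair r a b)) + 1 = Nat.card (Quot r) := by
  classical
  have hab : Quot.mk r a ≠ Quot.mk r b := fun e => h (Quot.eqvGen_exact e)
  -- The merged quotient is the old one without the class of `b`, which is redirected to the class
  -- of `a`.
  let e : Quot (addPair r a b) ≃ {q : Quot r // q ≠ Quot.mk r b} :=
    { toFun := Quot.lift
        (fun x => if hx : Quot.mk r x = Quot.mk r b then ⟨Quot.mk r a, hab⟩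
          else ⟨Quot.mk r x, hx⟩) (by
            rintro x y (hxy | ⟨rfl, rfl⟩)
            · have := Quot.sound hxy
              simp [this]
            · simp [hab])
      invFun := fun q => Quot.lift (fun x => Quot.mk (addPair r a b) x)
        (fun x y hxy => Quot.sound (.inl hxy)) q.1
      left_inv := by
        rintro ⟨x⟩
        by_cases hx : Quot.mk r x = Quot.mk r b
        · have h1 : Quot.mk (addPair r a b) a = Quot.mk (addPair r a b) b :=
            Quot.sound (.inr ⟨rfl, rfl⟩)
          have h2 : Quot.mk (addPair r a b) x = Quot.mk (addPair r a b) b :=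
            Quot.eqvGen_sound ((Quot.eqvGen_exact hx).mono fun _ _ h => .inl h)
          simp [hx, h1, h2]
        · simp [hx]
      right_inv := by
        rintro ⟨⟨x⟩, hx⟩
        simp [hx] }
  have : Fintype (Quot r) := Fintype.ofFinite _
  rw [Nat.card_congr e, Nat.card_eq_fintype_card, Nat.card_eq_fintype_card,
    Fintype.card_subtype_compl, Fintype.card_subtype_eq]
  exact Nat.sub_add_cancel (Fintype.card_pos_iff.2 ⟨Quot.mk r a⟩)

theorem card_quot_le_card_quot_addPair [Finite α] (r : α → α → Prop) (a b : α) :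
    Nat.card (Quot r) ≤ Nat.card (Quot (addPair r a b)) + 1 := by
  by_cases h : Relation.EqvGen r a b
  · exact (card_quot_addPair_of_eqvGen h).ge.trans (Nat.le_succ _)
  · exact (card_quot_addPair_of_not_eqvGen h).ge

theorem card_quot_addPair_le [Finite α] (r : α → α → Prop) (a b : α) :
    Nat.card (Quot (addPair r a b)) ≤ Nat.card (Quot r) :=
  Nat.card_quot_le_of_le fun _ _ h => .rel _ _ (.inl h)

theorem Finset.even_card_of_involution {A : Finset α} (f : α → α) (hf : ∀ x, f (f x) = x)
    (hA : ∀ x ∈ A, f x ∈ A) (hne : ∀ x ∈ A, f x ≠ x) : Even A.card := by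
  have h : ∑ _x ∈ A, (1 : ZMod 2) = 0 :=
    Finset.sum_involution (fun x _ => f x) (fun _ _ => by decide) (fun x hx _ => hne x hx)
      hA (fun x _ => hf x)
  rw [Finset.sum_const, nsmul_one] at h
  exact (ZMod.natCast_eq_zero_iff_even).1 h

/-- The adjacency relation of the multigraph whose edges are the elements of `A`, an edge `c`
joining `f c` to `g c`. -/
def linkRel (f g : β → α) (A : Finset β) (x y : α) : Prop := ∃ c ∈ A, x = f c ∧ y = g c

theorem linkRel_mono (f g : β → α) {A B : Finset β} (h : A ⊆ B) (x y : α)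
    (hxy : linkRel f g A x y) : linkRel f g B x y :=
  let ⟨c, hc, hx⟩ := hxy
  ⟨c, h hc, hx⟩

theorem linkRel_insert [DecidableEq β] (f g : β → α) (c : β) (A : Finset β) :
    linkRel f g (insert c A) = addPair (linkRel f g A) (f c) (g c) := by
  funext x y
  simp only [linkRel, addPair, Finset.mem_insert, eq_iff_iff]
  constructor
  · rintro ⟨d, rfl | hd, h⟩
    exacts [.inr h, .inl ⟨d, hd, h⟩]
  · rintro (⟨d, hd, h⟩ | h)
    exacts [⟨d, .inr hd, h⟩, ⟨c, .inl rfl, h⟩]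

theorem card_quot_linkRel_empty (f g : β → α) :
    Nat.card (Quot (linkRel f g ∅)) = Nat.card α := by
  refine Nat.card_congr ⟨Quot.lift id ?_, Quot.mk _, ?_, fun _ => rfl⟩
  · rintro x y ⟨c, hc, -⟩
    simp at hc
  · rintro ⟨x⟩
    rfl

/-- In a forest the number of components is the number of vertices minus the number of edges. -/
theorem card_quot_linkRel_of_acyclic [Finite α] [DecidableEq β] (f g : β → α) {B : Finset β}
    (hB : ∀ c ∈ B, ¬ Relation.EqvGen (linkRel f g (B.erase c)) (f c) (g c)) {A : Finset β}
    (hA : A ⊆ B) : Nat.card (Quot (linkRel f g A)) + A.card = Nat.card α := by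
  induction A using Finset.induction_on with
  | empty => simp [card_quot_linkRel_empty]
  | insert c A hc ih =>
    obtain ⟨hcB, hAB⟩ := Finset.insert_subset_iff.1 hA
    have h : ¬ Relation.EqvGen (linkRel f g A) (f c) (g c) := fun h =>
      hB c hcB (h.mono (linkRel_mono f g fun d hd => Finset.mem_erase.2
        ⟨ne_of_mem_of_not_mem hd hc, hAB hd⟩))
    have := card_quot_addPair_of_not_eqvGen h
    rw [linkRel_insert, Finset.card_insert_of_notMem hc]
    have := ih hAB
    omega

end Classes

/-! ### Changing the markers of a Kauffman state -/

theorem partner_partner (m : ℤˣ) (i : ZMod 4) : partner m (partner m i) = i := by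
  revert m i; decide

theorem partner_ne (m : ℤˣ) (i : ZMod 4) : partner m i ≠ i := by
  revert m i; decide

namespace OrientedDiagram

variable {C P : Type*} (D : OrientedDiagram C P)

theorem join_join (s : C → ℤˣ) (d : Dart C P) : join s (join s d) = d := by
  rcases d with ⟨c, i⟩ | ⟨x, b⟩ <;> simp [join, partner_partner]

theorem join_ne (s : C → ℤˣ) (d : Dart C P) : join s d ≠ d := by
  rcases d with ⟨c, i⟩ | ⟨x, b⟩ <;> simp [join, partner_ne]

theorem vertex_join (s : C → ℤˣ) (d : Dart C P) : (join s d).vertex = d.vertex := by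
  rcases d with ⟨c, i⟩ | ⟨x, b⟩ <;> rfl

/-- Two darts are consecutive on a circle of `D_s`. -/
def circleRel (s : C → ℤˣ) (d e : Dart C P) : Prop := e = D.opp d ∨ e = join s d

theorem circleOf_opp (s : C → ℤˣ) (d : Dart C P) : D.circleOf s (D.opp d) = D.circleOf s d :=
  (Quot.sound (.inl rfl)).symm

theorem circleOf_join (s : C → ℤˣ) (d : Dart C P) : D.circleOf s (join s d) = D.circleOf s d :=
  (Quot.sound (.inr rfl)).symm

theorem circleOf_partner (s : C → ℤˣ) (c : C) (i : ZMod 4) :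
    D.circleOf s (.inl (c, partner (s c) i)) = D.circleOf s (.inl (c, i)) :=
  D.circleOf_join s (.inl (c, i))

/-- Two darts are consecutive on a circle of `D_s`, not counting the smoothing at `p`. -/
def cutRel (s : C → ℤˣ) (p : C) (d e : Dart C P) : Prop :=
  e = D.opp d ∨ (e = join s d ∧ d.vertex ≠ .inl p)

/-- The arcs that are left when the smoothing at `p` is removed have two ends each. -/
theorem exists_ne_eqvGen_cutRel [Finite C] [Finite P] (s : C → ℤˣ) (p : C) (i : ZMod 4) :
    ∃ j, j ≠ i ∧ Relation.EqvGen (D.cutRel s p) (.inl (p, i)) (.inl (p, j)) := by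
  classical
  have := Fintype.ofFinite C
  have := Fintype.ofFinite P
  by_contra! hcon
  let A : Finset (Dart C P) := {d | Relation.EqvGen (D.cutRel s p) (.inl (p, i)) d}
  have hA : ∀ d, d ∈ A ↔ Relation.EqvGen (D.cutRel s p) (.inl (p, i)) d := by simp [A]
  have h0 : .inl (p, i) ∈ A := (hA _).2 (.refl _)
  have hp : ∀ d, d ∈ A.erase (.inl (p, i)) → d.vertex ≠ .inl p := by
    rintro (⟨c, j⟩ | ⟨x, b⟩) hd hv
    · obtain rfl : c = p := by simpa [Dart.vertex] using hv
      obtain ⟨h1, h2⟩ := Finset.mem_erase.1 hd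
      exact hcon j (fun e => h1 (by rw [e])) ((hA _).1 h2)
    · simp [Dart.vertex] at hv
  have e1 : Even A.card :=
    Finset.even_card_of_involution D.opp D.opp_opp
      (fun d hd => (hA _).2 (((hA _).1 hd).trans _ _ _ (.rel _ _ (.inl rfl))))
      (fun d _ => D.opp_ne d)
  -- The class is closed under `opp`; without its only end at `p` it is also closed under `join s`.
  -- Thus `A.card` and `A.card - 1` would both be even.
  have e2 : Even (A.erase (.inl (p, i))).card := by
    refine Finset.even_card_of_involution (join s) (join_join s) (fun d hd => ?_)
      (fun d _ => join_ne s d)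
    have hv := hp d hd
    refine Finset.mem_erase.2 ⟨fun e => hv ?_, (hA _).2
      (((hA _).1 (Finset.mem_of_mem_erase hd)).trans _ _ _ (.rel _ _ (.inr ⟨rfl, hv⟩)))⟩
    rw [← vertex_join s, e]
    rfl
  have := Finset.card_erase_add_one h0
  grind

/-! ### Changing a single marker -/

section Flip

variable {s t : C → ℤˣ} {p : C}

theorem join_eq_of_vertex_ne (h : ∀ c, c ≠ p → t c = s c) {d : Dart C P}
    (hd : d.vertex ≠ .inl p) : join t d = join s d := by
  rcases d with ⟨c, i⟩ | ⟨x, b⟩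
  · simp only [join]
    rw [h c fun e => hd (by rw [e]; rfl)]
  · rfl

theorem eqvGen_addPair_end (s : C → ℤˣ) (p : C) (i : ZMod 4) :
    Relation.EqvGen (addPair (D.circleRel s) (.inl (p, 0)) (.inl (p, 2)))
      (.inl (p, 0)) (.inl (p, i)) := by
  have e : ∀ (m : ℤˣ) (i : ZMod 4), i = 0 ∨ i = partner m 0 ∨ i = 2 ∨ i = partner m 2 := by decide
  have h02 : Relation.EqvGen (addPair (D.circleRel s) (.inl (p, 0)) (.inl (p, 2)))
      (.inl (p, 0)) (.inl (p, 2)) := .rel _ _ (.inr ⟨rfl, rfl⟩)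
  rcases e (s p) i with rfl | rfl | rfl | rfl
  · exact .refl _
  · exact .rel _ _ (.inl (.inr rfl))
  · exact h02
  · exact h02.trans _ _ _ (.rel _ _ (.inl (.inr rfl)))

theorem eqvGen_addPair_of_circleRel (h : ∀ c, c ≠ p → t c = s c) (d e : Dart C P)
    (hde : addPair (D.circleRel t) (.inl (p, 0)) (.inl (p, 2)) d e) :
    Relation.EqvGen (addPair (D.circleRel s) (.inl (p, 0)) (.inl (p, 2))) d e := by
  rcases hde with (rfl | rfl) | h
  · exact .rel _ _ (.inl (.inl rfl))
  · by_cases hd : d.vertex = .inl p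
    · rcases d with ⟨c, i⟩ | ⟨x, b⟩
      · obtain rfl : c = p := by simpa [Dart.vertex] using hd
        exact ((D.eqvGen_addPair_end s c i).symm _ _).trans _ _ _ (D.eqvGen_addPair_end s c _)
      · simp [Dart.vertex] at hd
    · rw [join_eq_of_vertex_ne h hd]
      exact .rel _ _ (.inl (.inr rfl))
  · exact .rel _ _ (.inr h)

variable [Finite C] [Finite P]

/-- Once the ends `0` and `2` at `p` are identified, either marker puts all four ends into one
class, so the marker at `p` no longer matters. This quotient is the common reference for comparing
`s` with `t`. -/
theorem card_quot_addPair_circleRel (h : ∀ c, c ≠ p → t c = s c) :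
    Nat.card (Quot (addPair (D.circleRel t) (.inl (p, 0)) (.inl (p, 2)))) =
      Nat.card (Quot (addPair (D.circleRel s) (.inl (p, 0)) (.inl (p, 2)))) :=
  Nat.card_quot_congr (D.eqvGen_addPair_of_circleRel h)
    (D.eqvGen_addPair_of_circleRel fun c hc => (h c hc).symm)

theorem numCircles_le_add_one (h : ∀ c, c ≠ p → t c = s c) :
    D.numCircles t ≤ D.numCircles s + 1 :=
  (card_quot_le_card_quot_addPair (D.circleRel t) _ _).trans
    (Nat.succ_le_succ ((D.card_quot_addPair_circleRel h).le.trans (card_quot_addPair_le _ _ _)))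

/-- Changing a marker at a crossing that links two circles merges these. -/
theorem numCircles_add_one_of_ne (h : ∀ c, c ≠ p → t c = s c) (hp : t p = - s p)
    (hne : D.circleOf s (.inl (p, 0)) ≠ D.circleOf s (.inl (p, 2))) :
    D.numCircles t + 1 = D.numCircles s := by
  have e : ∀ (m : ℤˣ) (i : ZMod 4), i = 0 ∨ i = partner m 0 ∨ i = 2 ∨ i = partner m 2 := by decide
  have e' : ∀ m : ℤˣ, partner m 0 = partner (-m) 2 := by decide
  obtain ⟨j, hj, h0j⟩ := D.exists_ne_eqvGen_cutRel s p 0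
  have hs : D.circleOf s (.inl (p, 0)) = D.circleOf s (.inl (p, j)) :=
    Quot.eqvGen_sound (h0j.mono fun _ _ h => h.imp id And.left)
  have ht : D.circleOf t (.inl (p, 0)) = D.circleOf t (.inl (p, j)) :=
    Quot.eqvGen_sound (h0j.mono fun _ _ hc => hc.imp id fun hc => by
      rw [join_eq_of_vertex_ne h hc.2]; exact hc.1)
  -- The arc leaving the end `0` must return to `p` on the same circle, and the ends on the other
  -- smoothing arc belong to a different circle. The new marker joins this end `j` to `2`, so `0`
  -- and `2` share a circle of `t`.
  have hj' : j = partner (s p) 0 := by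
    rcases e (s p) j with rfl | rfl | rfl | rfl
    · exact absurd rfl hj
    · rfl
    · exact absurd hs hne
    · exact absurd (hs.trans (D.circleOf_partner s p 2)) hne
  rw [hj', e', ← hp, D.circleOf_partner] at ht
  have h1 := card_quot_addPair_of_eqvGen (r := D.circleRel t) (Quot.eqvGen_exact ht)
  have h2 := card_quot_addPair_of_not_eqvGen (r := D.circleRel s)
    fun h => hne (Quot.eqvGen_sound h)
  rw [D.card_quot_addPair_circleRel h] at h1
  rw [h1] at h2
  exact h2

end Flip

/-- The state `s` with the markers in `A` changed. -/
def flip [DecidableEq C] (s : C → ℤˣ) (A : Finset C) (c : C) : ℤˣ := if c ∈ A then - s c else s c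

/-- The adjacency relation of the subgraph of `stateGraph` with edge set `A`. -/
def stateRel (s : C → ℤˣ) (A : Finset C) : D.Circle s → D.Circle s → Prop :=
  linkRel (fun c => D.circleOf s (.inl (c, 0))) (fun c => D.circleOf s (.inl (c, 2))) A

instance [Finite C] [Finite P] (s : C → ℤˣ) : Finite (D.Circle s) :=
  inferInstanceAs (Finite (Quot _))

theorem mk_stateRel_end {s : C → ℤˣ} {A : Finset C} {c : C} (hc : c ∈ A) (i : ZMod 4) :
    Quot.mk (D.stateRel s A) (D.circleOf s (.inl (c, i))) =
      Quot.mk (D.stateRel s A) (D.circleOf s (.inl (c, 0))) := by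
  have e : ∀ (m : ℤˣ) (i : ZMod 4), i = 0 ∨ i = partner m 0 ∨ i = 2 ∨ i = partner m 2 := by decide
  have h : Quot.mk (D.stateRel s A) (D.circleOf s (.inl (c, 2))) =
      Quot.mk (D.stateRel s A) (D.circleOf s (.inl (c, 0))) :=
    (Quot.sound ⟨c, hc, rfl, rfl⟩).symm
  rcases e (s c) i with rfl | rfl | rfl | rfl
  · rfl
  · rw [circleOf_partner]
  · exact h
  · rw [circleOf_partner, h]

/-- With all edges present, the four ends at a crossing lie in one component of the state graph, so
components of the diagram map onto those of the state graph. -/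
theorem card_quot_stateRel_univ_le [Fintype C] [Finite P] (s : C → ℤˣ) :
    Nat.card (Quot (D.stateRel s Finset.univ)) ≤ Nat.card D.Component := by
  have : Finite D.Component := inferInstanceAs (Finite (Quot _))
  refine Nat.card_le_card_of_surjective (Quot.lift
    (fun d => Quot.mk (D.stateRel s Finset.univ) (D.circleOf s d)) ?_) ?_
  · rintro d e (rfl | h)
    · rw [circleOf_opp]
    · rcases d with ⟨c, i⟩ | ⟨x, b⟩ <;> rcases e with ⟨c', i'⟩ | ⟨x', b'⟩ <;>
        simp only [Dart.vertex, Sum.inl.injEq, Sum.inr.injEq, reduceCtorEq] at h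
      · subst h
        rw [D.mk_stateRel_end (Finset.mem_univ _), D.mk_stateRel_end (Finset.mem_univ _) i']
      · subst h
        by_cases hb : b' = b
        · rw [hb]
        · obtain rfl : b' = !b := by cases b <;> cases b' <;> simp_all
          exact congrArg _ (D.circleOf_join s (.inr (x', b))).symm
  · rintro ⟨⟨d⟩⟩
    exact ⟨Quot.mk _ d, rfl⟩

variable [DecidableEq C]

theorem mk_stateRel_join_flip (s : C → ℤˣ) (A : Finset C) (d : Dart C P) :
    Quot.mk (D.stateRel s A) (D.circleOf s (join (flip s A) d)) =
      Quot.mk (D.stateRel s A) (D.circleOf s d) := by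
  rcases d with ⟨c, i⟩ | ⟨x, b⟩
  · by_cases hc : c ∈ A
    · simp only [join]
      rw [D.mk_stateRel_end hc, D.mk_stateRel_end hc i]
    · simp only [join, flip, hc, if_false, circleOf_partner]
  · exact congrArg _ (D.circleOf_join s (.inr (x, b)))

/-- A circle of the changed state runs within one component of the subgraph `A`: it can leave a
circle of `s` only at a crossing in `A`. -/
theorem mk_stateRel_eq_of_circleOf_flip_eq {s : C → ℤˣ} {A : Finset C} {d e : Dart C P}
    (h : D.circleOf (flip s A) d = D.circleOf (flip s A) e) :
    Quot.mk (D.stateRel s A) (D.circleOf s d) = Quot.mk (D.stateRel s A) (D.circleOf s e) :=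
  congrArg (Quot.lift (fun d => Quot.mk (D.stateRel s A) (D.circleOf s d)) (by
    rintro a b (rfl | rfl)
    · rw [circleOf_opp]
    · rw [mk_stateRel_join_flip])) h

/-- The number of circles after changing the markers in `A`, in terms of the number of components
of the subgraph of the state graph with edge set `A`. -/
theorem numCircles_flip_add_le [Finite C] [Finite P] (s : C → ℤˣ) (A : Finset C) :
    D.numCircles (flip s A) + D.numCircles s ≤ 2 * Nat.card (Quot (D.stateRel s A)) + A.card := by
  induction A using Finset.induction_on with
  | empty =>
    have h : flip s ∅ = s := by funext c; simp [flip]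
    rw [stateRel, card_quot_linkRel_empty, h, numCircles]
    simp [two_mul]
  | insert c A hc ih =>
    have hne : ∀ b, b ≠ c → flip s (insert c A) b = flip s A b := by
      intro b hb; simp [flip, hb]
    have hcc : flip s (insert c A) c = - flip s A c := by simp [flip, hc]
    rw [Finset.card_insert_of_notMem hc, stateRel, linkRel_insert]
    by_cases h : Relation.EqvGen (D.stateRel s A) (D.circleOf s (.inl (c, 0)))
        (D.circleOf s (.inl (c, 2)))
    -- The edge closes a cycle: `k` is unchanged, the right side grows by one, and the circles grow
    -- by at most one.
    · have h1 := card_quot_addPair_of_eqvGen h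
      have h2 := D.numCircles_le_add_one hne
      rw [stateRel] at h1 ih
      omega
    -- The edge joins two components: the right side drops by one. So does the number of circles,
    -- since circles in different components are distinct and get merged.
    · have h1 := card_quot_addPair_of_not_eqvGen h
      have h2 := D.numCircles_add_one_of_ne hne hcc
        fun e => h (Quot.eqvGen_exact (D.mk_stateRel_eq_of_circleOf_flip_eq e))
      rw [stateRel] at h1 ih
      omega

/-- Two opposite states of a connected diagram have at most `n + 2` circles together. -/
theorem numCircles_neg_add_le [Fintype C] [Finite P] (s : C → ℤˣ) :
    D.numCircles (fun c => - s c) + D.numCircles s ≤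
      2 * Nat.card D.Component + Fintype.card C := by
  have h : flip s Finset.univ = fun c => - s c := by funext c; simp [flip]
  have h1 := D.numCircles_flip_add_le s Finset.univ
  have h2 := D.card_quot_stateRel_univ_le s
  rw [h, Finset.card_univ] at h1
  omega

end OrientedDiagram

/-! ### Faces of alternating diagrams -/

namespace OrientedDiagram

variable {C P : Type*} (D : OrientedDiagram C P)

/-- A two-colouring of the darts that alternates along the link and separates the ends of the
overstrand from those of the understrand. -/
structure IsColoring (κ : Dart C P → Bool) : Prop where
  opp : ∀ d, κ (D.opp d) = !κ d
  cross : ∀ c i, κ (.inl (c, i)) = decide (IsOver i)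
  mark : ∀ x b, κ (.inr (x, !b)) = !κ (.inr (x, b))

section Faces

variable {D} {κ : Dart C P → Bool}

theorem IsColoring.join (h : D.IsColoring κ) (s : C → ℤˣ) (d : Dart C P) :
    κ (join s d) = !κ d := by
  have e : ∀ (m : ℤˣ) (i : ZMod 4), decide (IsOver (partner m i)) = !decide (IsOver i) := by decide
  rcases d with ⟨c, i⟩ | ⟨x, b⟩
  · simp only [OrientedDiagram.join, h.cross, e]
  · exact h.mark x b

/-- Turning around a vertex from a dart follows the state of one sign. -/
theorem IsColoring.rot_eq_join (h : D.IsColoring κ) (d : Dart C P) :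
    d.rot = OrientedDiagram.join (fun _ => if κ d then -1 else 1) d := by
  have e : ∀ i : ZMod 4, i + 1 = partner (if decide (IsOver i) then -1 else 1) i := by decide
  rcases d with ⟨c, i⟩ | ⟨x, b⟩
  · simp only [OrientedDiagram.join, Dart.rot, h.cross]
    rw [← e]
  · rfl

/-- The face to which a dart belongs. -/
def faceOf (D : OrientedDiagram C P) (d : Dart C P) : D.Face := Quot.mk _ d

/-- The face that lies on the side of colour `b` along the arc through a dart. -/
def faceAt (D : OrientedDiagram C P) (κ : Dart C P → Bool) (b : Bool) (d : Dart C P) : D.Face :=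
  if κ d = b then D.faceOf d else D.faceOf (D.opp d)

theorem IsColoring.faceAt_opp (h : D.IsColoring κ) (b : Bool) (d : Dart C P) :
    faceAt D κ b (D.opp d) = faceAt D κ b d := by
  simp only [faceAt, h.opp, D.opp_opp]
  cases κ d <;> cases b <;> rfl

/-- The dart joined to `d` has the opposite colour, and turning from it uses this same marker and
returns to `d`. Hence walking along a circle of this state stays on one face. -/
theorem IsColoring.faceAt_join_of_eq (h : D.IsColoring κ) {b : Bool} {d : Dart C P}
    (hd : κ d = b) :
    faceAt D κ b (OrientedDiagram.join (fun _ => if b then 1 else -1) d) = faceAt D κ b d := by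
  set s : C → ℤˣ := fun _ => if b then 1 else -1
  have h1 : κ (OrientedDiagram.join s d) = !b := by rw [h.join, hd]
  have h2 : (OrientedDiagram.join s d).rot = d := by
    rw [h.rot_eq_join, h1]
    conv_rhs => rw [← join_join s d]
    congr 1
    cases b <;> rfl
  have h3 : ¬ κ (OrientedDiagram.join s d) = b := by rw [h1]; simp
  rw [faceAt, if_neg h3, faceAt, if_pos hd]
  exact Quot.sound (by rw [D.opp_opp, h2])

theorem IsColoring.faceAt_join (h : D.IsColoring κ) (b : Bool) (d : Dart C P) :
    faceAt D κ b (OrientedDiagram.join (fun _ => if b then 1 else -1) d) = faceAt D κ b d := by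
  by_cases hd : κ d = b
  · exact h.faceAt_join_of_eq hd
  · have h1 : κ (OrientedDiagram.join (fun _ => if b then 1 else -1) d) = b := by
      rw [h.join]; cases b <;> simp_all
    have h2 := h.faceAt_join_of_eq h1
    rw [join_join] at h2
    exact h2.symm

/-- Each face contains a dart `d`, and the circle through `d` in the state selected by the colour of
`d` is sent to that face. -/
theorem IsColoring.card_face_le [Finite C] [Finite P] (h : D.IsColoring κ) :
    Nat.card D.Face ≤ D.numCircles (fun _ => 1) + D.numCircles (fun _ => -1) := by
  let F (b : Bool) : D.Circle (fun _ => if b then 1 else -1) → D.Face :=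
    Quot.lift (faceAt D κ b) (by
      rintro d e (rfl | rfl)
      · exact (h.faceAt_opp b d).symm
      · exact (h.faceAt_join b d).symm)
  rw [numCircles, numCircles, ← Nat.card_sum]
  refine Nat.card_le_card_of_surjective (Sum.elim (F true) (F false)) ?_
  rintro ⟨d⟩
  cases hd : κ d
  · exact ⟨.inr (D.circleOf _ d), if_pos hd⟩
  · exact ⟨.inl (D.circleOf _ d), if_pos hd⟩

end Faces

/-- The two ends of an arc of an alternating diagram are oppositely directed. -/
theorem IsAlternating.out_ne [Finite C] [Finite P] (halt : D.IsAlternating) {d e : C × ZMod 4}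
    (hde : d ≠ e) (h : D.SameArc (.inl d) (.inl e)) : D.out (.inl e) ≠ D.out (.inl d) := by
  classical
  have := Fintype.ofFinite C
  have := Fintype.ofFinite P
  let A : Finset (Dart C P) := {x | D.SameArc (.inl d) x}
  have hA : ∀ x, x ∈ A ↔ D.SameArc (.inl d) x := by simp [A]
  let ε (x : Dart C P) : ℤ := if D.out x then 1 else -1
  have hε : ∀ x y, D.out y = !D.out x → ε x + ε y = 0 := by
    intro x y hxy
    simp only [ε, hxy]
    cases D.out x <;> simp
  have hε0 : ∀ x, ε x ≠ 0 := fun x => by simp only [ε]; split_ifs <;> simp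
  -- The directions cancel along edges, and also across marked points, so those at the crossing ends
  -- of the arc cancel too.
  have h1 : ∑ x ∈ A, ε x = 0 :=
    Finset.sum_involution (fun x _ => D.opp x) (fun x _ => hε _ _ (D.out_opp x))
      (fun x _ _ => D.opp_ne x) (fun x hx => (hA _).2 (((hA _).1 hx).trans _ _ _
        (.rel _ _ (.inl rfl)))) (fun x _ => D.opp_opp x)
  have h2 : ∑ x ∈ A with ¬ x.isLeft, ε x = 0 := by
    refine Finset.sum_involution (fun x _ => x.through) (fun x _ => hε _ _ (D.out_through x))
      (fun x hx _ => ?_) (fun x hx => ?_) (fun x hx => ?_)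
    all_goals
      obtain ⟨hxA, hx⟩ := Finset.mem_filter.1 hx
      rcases x with x | ⟨x, b⟩
      · simp at hx
    · simp [Dart.through]
    · exact Finset.mem_filter.2 ⟨(hA _).2 (((hA _).1 hxA).trans _ _ _
        (.rel _ _ (.inr ⟨x, b, rfl, rfl⟩))), by simp [Dart.through]⟩
    · simp [Dart.through]
  -- A third crossing end is impossible: three ends cannot be pairwise of opposite type, over and
  -- under.
  have h3 : A.filter (fun x => x.isLeft) = {.inl d, .inl e} := by
    ext x
    rw [Finset.mem_filter, hA, Finset.mem_insert, Finset.mem_singleton]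
    constructor
    · rintro ⟨hx, hl⟩
      rcases x with x | x
      · by_contra! hne
        have hd : d ≠ x := fun h => hne.1 (by rw [h])
        have he : e ≠ x := fun h => hne.2 (by rw [h])
        have a1 := halt d e hde h
        have a2 := halt d x hd hx
        have a3 := halt e x he ((h.symm _ _).trans _ _ _ hx)
        tauto
      · simp at hl
    · rintro (rfl | rfl)
      exacts [⟨.refl _, rfl⟩, ⟨h, rfl⟩]
  have h4 := Finset.sum_filter_add_sum_filter_not A (fun x => x.isLeft) ε
  rw [h1, h2, h3, Finset.sum_pair (by simpa using hde)] at h4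
  intro ho
  apply hε0 (.inl d)
  simp only [ε, ho] at h4 ⊢
  omega

theorem IsAlternating.exists_isColoring [Finite C] [Finite P] (halt : D.IsAlternating) :
    ∃ κ, D.IsColoring κ := by
  classical
  -- `f` is constant on arcs and corrects `out`, which already alternates, to match over and under
  -- at crossings. Type and direction both reverse between the ends of an arc, so one correction
  -- fits both. An arc without crossings gets `false`.
  let f (d : Dart C P) : Bool :=
    decide (∃ e : C × ZMod 4, D.SameArc d (.inl e) ∧ decide (IsOver e.2) ≠ D.out (.inl e))
  have hf : ∀ d d', D.SameArc d d' → f d = f d' := by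
    intro d d' h
    simp only [f, decide_eq_decide]
    exact ⟨fun ⟨e, he, h'⟩ => ⟨e, (h.symm _ _).trans _ _ _ he, h'⟩,
      fun ⟨e, he, h'⟩ => ⟨e, h.trans _ _ _ he, h'⟩⟩
  have hopp : ∀ d, f (D.opp d) = f d := fun d => (hf _ _ (.rel _ _ (.inl rfl))).symm
  have hmark : ∀ x b, f (.inr (x, !b)) = f (.inr (x, b)) := fun x b =>
    (hf _ _ (.rel _ _ (.inr ⟨x, b, rfl, rfl⟩))).symm
  refine ⟨fun d => xor (D.out d) (f d), fun d => ?_, fun c i => ?_, fun x b => ?_⟩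
  · simp only [D.out_opp, hopp, Bool.not_xor]
  · by_cases h : decide (IsOver i) = D.out (.inl (c, i))
    · have : f (.inl (c, i)) = false := by
        refine decide_eq_false ?_
        rintro ⟨e, he, hne⟩
        by_cases hce : (c, i) = e
        · subst hce
          exact hne h
        · have h1 := halt _ _ hce he
          have h2 := halt.out_ne D hce he
          apply hne
          rw [decide_eq_decide.2 h1, decide_not, h]
          revert h2
          cases D.out (.inl e) <;> cases D.out (.inl (c, i)) <;> simp
      simp [this, h]
    · have : f (.inl (c, i)) = true := decide_eq_true ⟨_, .refl _, h⟩
      simp only [this, Bool.xor_true]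
      revert h
      cases decide (IsOver i) <;> cases D.out (.inl (c, i)) <;> simp
  · have : D.out (.inr (x, !b)) = !D.out (.inr (x, b)) := D.out_through (.inr (x, b))
    simp only [this, hmark, Bool.not_xor]

/-- For a planar connected alternating diagram the circles of the two extreme states are the
faces. -/
theorem add_two_le_numCircles [Fintype C] [Finite P] (hplanar : D.IsPlanar)
    (hconn : D.IsConnected) (halt : D.IsAlternating) :
    Fintype.card C + 2 ≤ D.numCircles (fun _ => 1) + D.numCircles (fun _ => -1) := by
  obtain ⟨κ, hκ⟩ := halt.exists_isColoring
  have h := hκ.card_face_le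
  -- Marked points cancel in Euler's formula, leaving `n + 2` faces.
  rw [IsPlanar, hconn, Nat.card_eq_fintype_card (α := C)] at hplanar
  omega

end OrientedDiagram

/-! ### Spanning trees of state graphs -/

namespace OrientedDiagram

variable {C P : Type*} (D : OrientedDiagram C P)

section Trees

variable {D} {s : C → ℤˣ}

theorem eqvGen_adj_iff {H : Graph (D.Circle s) C} (hH : H ≤ D.stateGraph s) {B : Finset C}
    (hB : ∀ c, c ∈ B ↔ c ∈ H.edgeSet) (x y : D.Circle s) :
    Relation.EqvGen H.Adj x y ↔ Relation.EqvGen (D.stateRel s B) x y := by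
  have hlink : ∀ c ∈ B, H.IsLink c (D.circleOf s (.inl (c, 0))) (D.circleOf s (.inl (c, 2))) :=
    fun c hc => (hH.isLink_iff ((hB c).1 hc)).2 (.inl ⟨rfl, rfl⟩)
  constructor
  · intro h
    refine Relation.EqvGen.eqvGen_le (fun x y hxy => ?_) _ _ h
    obtain ⟨c, hc⟩ := hxy
    have hcB : c ∈ B := (hB c).2 hc.edge_mem
    rcases hc.mono hH with ⟨rfl, rfl⟩ | ⟨rfl, rfl⟩
    · exact .rel _ _ ⟨c, hcB, rfl, rfl⟩
    · exact .symm _ _ (.rel _ _ ⟨c, hcB, rfl, rfl⟩)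
  · intro h
    refine h.mono ?_
    rintro _ _ ⟨c, hc, rfl, rfl⟩
    exact ⟨c, hlink c hc⟩

variable [DecidableEq C]

theorem eqvGen_adj_deleteEdges_iff {H : Graph (D.Circle s) C} (hH : H ≤ D.stateGraph s)
    {B : Finset C} (hB : ∀ c, c ∈ B ↔ c ∈ H.edgeSet) (e : C) (x y : D.Circle s) :
    Relation.EqvGen (H.deleteEdges {e}).Adj x y ↔
      Relation.EqvGen (D.stateRel s (B.erase e)) x y := by
  refine eqvGen_adj_iff (Graph.deleteEdges_le.trans hH) (fun c => ?_) x y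
  rw [Finset.mem_erase, hB, Graph.edgeSet_deleteEdges, Set.mem_sdiff, Set.mem_singleton_iff,
    and_comm]

/-- The number of components of a subgraph of a spanning tree. -/
theorem card_quot_stateRel_of_isSpanningTree [Finite C] [Finite P] {T : Graph (D.Circle s) C}
    (hT : T.IsSpanningTree (D.stateGraph s)) {B : Finset C} (hB : ∀ c, c ∈ B ↔ c ∈ T.edgeSet)
    {A : Finset C} (hA : A ⊆ B) :
    Nat.card (Quot (D.stateRel s A)) + A.card = D.numCircles s := by
  refine card_quot_linkRel_of_acyclic _ _ (fun c hc h => ?_) hA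
  exact hT.2.acyclic c _ _ ((hT.1.le.isLink_iff ((hB c).1 hc)).2 (.inl ⟨rfl, rfl⟩))
    ((eqvGen_adj_deleteEdges_iff hT.1.le hB c _ _).2 h)

theorem card_edges_of_isSpanningTree [Finite C] [Finite P] {T : Graph (D.Circle s) C}
    (hT : T.IsSpanningTree (D.stateGraph s)) {B : Finset C} (hB : ∀ c, c ∈ B ↔ c ∈ T.edgeSet) :
    B.card + 1 = D.numCircles s := by
  have h1 : Nat.card (Quot (D.stateRel s B)) = 1 := by
    have hV : ∀ x, x ∈ T.vertexSet := fun x => by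
      rw [hT.1.vertexSet_eq]
      exact Set.mem_univ x
    obtain ⟨x, -⟩ := hT.2.nonempty
    refine Nat.card_eq_one_iff_exists.2 ⟨Quot.mk _ x, ?_⟩
    rintro ⟨y⟩
    exact Quot.eqvGen_sound ((eqvGen_adj_iff hT.1.le hB y x).1
      (hT.2.connected y (hV y) x (hV x)))
  have h2 := card_quot_stateRel_of_isSpanningTree hT hB subset_rfl
  omega

/-- The state graph of a connected diagram has a spanning tree. -/
theorem IsConnected.exists_isSpanningTree [Fintype C] [Finite P] (hconn : D.IsConnected)
    (s : C → ℤˣ) : ∃ T, Graph.IsSpanningTree T (D.stateGraph s) := by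
  classical
  -- A smallest connecting edge set is a tree: an edge whose ends stay connected without it could be
  -- dropped.
  obtain ⟨B, hB, hmin⟩ := Finset.exists_min_image
    {B : Finset C | Nat.card (Quot (D.stateRel s B)) ≤ 1} Finset.card
    ⟨Finset.univ, by simpa [hconn.symm] using D.card_quot_stateRel_univ_le s⟩
  simp only [Finset.mem_filter, Finset.mem_univ, true_and] at hB hmin
  have hE : ∀ c, c ∈ B ↔ c ∈ ((D.stateGraph s).restrict B).edgeSet := by
    intro c
    rw [Graph.edgeSet_restrict]
    exact ⟨fun h => ⟨⟨_, _, .inl ⟨rfl, rfl⟩⟩, h⟩, fun h => h.2⟩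
  have hle : (D.stateGraph s).restrict B ≤ D.stateGraph s := Graph.restrict_le
  refine ⟨(D.stateGraph s).restrict B, ⟨hle, rfl⟩, ?_, ?_, ?_⟩
  · obtain ⟨⟨d⟩, -⟩ := Nat.card_eq_one_iff_exists.1 hconn
    exact ⟨D.circleOf s d, Set.mem_univ _⟩
  · intro x _ y _
    have := (Finite.card_le_one_iff_subsingleton (α := Quot (D.stateRel s B))).1 hB
    exact (eqvGen_adj_iff hle hE x y).2 (Quot.eqvGen_exact (Subsingleton.elim _ _))
  · intro e x y he h
    have heB : e ∈ B := he.1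
    rw [eqvGen_adj_deleteEdges_iff hle hE] at h
    have h' : Relation.EqvGen (D.stateRel s (B.erase e)) (D.circleOf s (.inl (e, 0)))
        (D.circleOf s (.inl (e, 2))) := by
      rcases he.2 with ⟨rfl, rfl⟩ | ⟨rfl, rfl⟩
      exacts [h, h.symm _ _]
    have h1 := card_quot_addPair_of_eqvGen h'
    rw [stateRel, ← linkRel_insert, Finset.insert_erase heB] at h1
    have h2 := hmin (B.erase e) (h1.symm.le.trans hB)
    have h3 := Finset.card_erase_lt_of_mem heB
    omega

end Trees

/-! ### The Seifert state -/

theorem seifertState_eq_sign : D.seifertState = D.sign := by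
  funext c
  have h0 : D.out (.inl (c, 2)) = !D.out (.inl (c, 0)) := D.out_through (.inl (c, 0))
  simp only [seifertState, sign, h0]
  cases D.out (.inl (c, 0)) <;> cases D.out (.inl (c, 1)) <;> rfl

theorem ncard_sign [Fintype C] :
    {c | D.sign c = 1}.ncard + {c | D.sign c = -1}.ncard = Fintype.card C ∧
      D.writhe = {c | D.sign c = 1}.ncard - {c | D.sign c = -1}.ncard := by
  have h : ∀ m : ℤˣ, {c | D.sign c = m}.ncard = ∑ c, if D.sign c = m then 1 else 0 := by
    intro m
    rw [← Finset.card_filter, ← Set.ncard_coe_finset]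
    congr 1
    ext c
    simp
  have e : ∀ n : ℤˣ, ((if n = 1 then 1 else 0) + if n = -1 then 1 else 0) = 1 ∧
      (n : ℤ) = (if n = 1 then 1 else 0) - (if n = -1 then 1 else 0) := by decide
  rw [h, h]
  constructor
  · rw [← Finset.sum_add_distrib, Finset.sum_congr rfl fun c _ => (e (D.sign c)).1]
    simp
  · rw [writhe, Finset.sum_congr rfl fun c _ => (e (D.sign c)).2, Finset.sum_sub_distrib]
    push_cast
    rfl

theorem unsmooth_join (p : C) (m : ℤˣ) {s : {c : C // c ≠ p} → ℤˣ} {t : C → ℤˣ}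
    (ht : ∀ c, t c.1 = s c) (hp : t p = m) (d : Dart {c : C // c ≠ p} (P ⊕ Bool)) :
    unsmooth p m (join s d) = join t (unsmooth p m d) := by
  rcases d with ⟨⟨c, hc⟩, i⟩ | ⟨x | (_ | _), (_ | _)⟩ <;>
    simp [unsmooth, join, ← ht, hp, partner_partner]

variable [DecidableEq C]

/-- Changing the Seifert markers at the crossings of sign `-m` yields the constant state `m`. The
component count in the general bound is at most that of the tree edges of sign `-m`, which form a
forest. -/
theorem numCircles_const_le [Fintype C] [Finite P] {T : Graph (D.Circle D.seifertState) C}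
    (hT : T.IsSpanningTree D.seifertGraph) (m : ℤˣ) :
    D.numCircles (fun _ => m) + 2 * {c ∈ T.edgeSet | D.sign c = -m}.ncard ≤
      D.numCircles D.seifertState + {c | D.sign c = -m}.ncard := by
  classical
  let B := T.edgeSet.toFinset
  have hB : ∀ c, c ∈ B ↔ c ∈ T.edgeSet := fun c => Set.mem_toFinset
  have e : ∀ m n : ℤˣ, (if n = -m then -n else n) = m := by decide
  have hflip : flip D.seifertState {c | D.sign c = -m} = fun _ => m := by
    funext c
    simp only [flip, Finset.mem_filter, Finset.mem_univ, true_and, seifertState_eq_sign, e]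
  have h1 := D.numCircles_flip_add_le D.seifertState {c | D.sign c = -m}
  have h2 := card_quot_stateRel_of_isSpanningTree hT hB (B.filter_subset fun c => D.sign c = -m)
  have h3 : Nat.card (Quot (D.stateRel D.seifertState {c | D.sign c = -m})) ≤
      Nat.card (Quot (D.stateRel D.seifertState (B.filter fun c => D.sign c = -m))) :=
    Nat.card_quot_le_of_le fun x y h => .rel _ _ (linkRel_mono _ _
      (Finset.filter_subset_filter _ (Finset.subset_univ B)) x y h)
  have h4 : {c ∈ T.edgeSet | D.sign c = -m}.ncard = (B.filter fun c => D.sign c = -m).card := by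
    rw [← Set.ncard_coe_finset]
    congr 1
    ext c
    simp [hB]
  have h5 : {c | D.sign c = -m}.ncard = (Finset.univ.filter fun c => D.sign c = -m).card := by
    rw [← Set.ncard_coe_finset]
    congr 1
    ext c
    simp
  rw [hflip] at h1
  rw [h4, h5]
  omega

theorem dPlus_add_dMinus [Fintype C] [Finite P] {T : Graph (D.Circle D.seifertState) C}
    (hT : T.IsSpanningTree D.seifertGraph) :
    D.dPlus T + D.dMinus T + 1 = D.numCircles D.seifertState := by
  classical
  rw [← card_edges_of_isSpanningTree hT (B := T.edgeSet.toFinset) fun c => Set.mem_toFinset,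
    ← Set.ncard_eq_toFinset_card', dPlus, dMinus, ← Set.ncard_union_eq]
  · congr 2
    ext c
    rcases Int.units_eq_one_or (D.sign c) with h | h <;> simp [h]
  · rw [Set.disjoint_left]
    rintro c ⟨-, h⟩ ⟨-, h'⟩
    rw [h] at h'
    exact absurd h' (by decide)

/-- The writhe and the extreme states determine the signs of the edges of a spanning tree. -/
theorem dPlus_sub_dMinus [Fintype C] [Finite P] (hplanar : D.IsPlanar) (hconn : D.IsConnected)
    (halt : D.IsAlternating) {T : Graph (D.Circle D.seifertState) C}
    (hT : T.IsSpanningTree D.seifertGraph) :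
    D.writhe + D.numCircles (fun _ => 1) - D.numCircles (fun _ => -1) =
      2 * ((D.dPlus T : ℤ) - D.dMinus T) := by
  have h1 := D.add_two_le_numCircles hplanar hconn halt
  have h2 := D.numCircles_const_le hT 1
  have h3 := D.numCircles_const_le hT (-1)
  have h4 := D.dPlus_add_dMinus hT
  obtain ⟨h5, h6⟩ := D.ncard_sign
  rw [neg_neg] at h3
  rw [← dPlus] at h3
  rw [← dMinus] at h2
  -- The sum of `h2` and `h3` gives the upper bound `n + 2`, so `h1` forces equality in both.
  omega

/-! ### Smoothing a crossing along the orientation -/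

/-- The smoothed diagram has the same darts as `D`; its two new marked points act as the Seifert
marker at `p`. -/
theorem numCircles_smooth (p : C) {s : {c : C // c ≠ p} → ℤˣ} {t : C → ℤˣ}
    (ht : ∀ c, t c.1 = s c) (hp : t p = D.sign p) :
    (D.smooth p).numCircles s = D.numCircles t := by
  rw [← seifertState_eq_sign] at hp
  refine Nat.card_congr (Quot.congr ⟨unsmooth p (D.seifertState p), resmooth p (D.seifertState p),
    resmooth_unsmooth _ _, unsmooth_resmooth _ _⟩ fun d e => ?_)
  have hinj := Function.LeftInverse.injective (resmooth_unsmooth (P := P) p (D.seifertState p))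
  change (e = resmooth p _ (D.opp (unsmooth p _ d)) ∨ e = join s d) ↔
    (unsmooth p _ e = D.opp (unsmooth p _ d) ∨ unsmooth p _ e = join t (unsmooth p _ d))
  rw [← unsmooth_join p _ ht hp, hinj.eq_iff, ← hinj.eq_iff (a := e), unsmooth_resmooth]

theorem writhe_smooth [Fintype C] (p : C) : D.writhe = D.sign p + (D.smooth p).writhe :=
  Fintype.sum_eq_add_sum_subtype_ne (fun c => (D.sign c : ℤ)) p

theorem smooth_invariant [Fintype C] [Finite P] (hplanar : D.IsPlanar) (hconn : D.IsConnected)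
    (halt : D.IsAlternating) {p : C} (hp : ¬ D.IsNugatory p) :
    (D.smooth p).writhe + (D.smooth p).numCircles (fun _ => 1)
        - (D.smooth p).numCircles (fun _ => -1) =
      D.writhe + D.numCircles (fun _ => 1) - D.numCircles (fun _ => -1) := by
  have h1 := D.add_two_le_numCircles hplanar hconn halt
  have h2 := (D.smooth p).numCircles_neg_add_le fun _ => 1
  have h3 : Nat.card (D.smooth p).Component ≤ 1 := (not_lt.1 hp).trans hconn.le
  have h4 : Fintype.card {c : C // c ≠ p} + 1 = Fintype.card C := by
    rw [Fintype.card_subtype_compl, Fintype.card_subtype_eq]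
    exact Nat.sub_add_cancel (Fintype.card_pos_iff.2 ⟨p⟩)
  have h5 := D.writhe_smooth p
  have h6 : ∀ m : ℤˣ, (D.smooth p).numCircles (fun _ => m) =
      D.numCircles (Function.update (fun _ => m) p (D.sign p)) := fun m =>
    D.numCircles_smooth p (fun c => by simp [c.2]) (by simp)
  have h7 : ∀ m : ℤˣ, D.numCircles (fun _ => m) ≤ (D.smooth p).numCircles (fun _ => m) + 1 := by
    intro m
    rw [h6]
    exact D.numCircles_le_add_one (p := p) fun c hc => by simp [hc]
  have h8 : ∀ m : ℤˣ, D.sign p = m →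
      (D.smooth p).numCircles (fun _ => m) = D.numCircles (fun _ => m) := by
    rintro m rfl
    rw [h6, Function.update_eq_self_iff.2 rfl]
  have h71 := h7 1
  have h7n := h7 (-1)
  -- The extreme state agreeing with the sign of `p` keeps its circles. The other loses at most one
  -- by `h7`, and at least one because the smoothed total is at most `n + 1`. This loss balances the
  -- change of the writhe.
  rcases Int.units_eq_one_or (D.sign p) with h | h <;>
    have h8 := h8 _ h <;> rw [h] at h5 <;> push_cast at h5 <;> omega

end OrientedDiagram

theorem lemma7p5 {C P : Type*} [Fintype C] [DecidableEq C] [Fintype P]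
    (D : OrientedDiagram C P) (hplanar : D.IsPlanar) (hconn : D.IsConnected)
    (halt : D.IsAlternating) :
    (∃ T, Graph.IsSpanningTree T D.seifertGraph) ∧
    (∃ dp dm : ℕ,
      (∀ T, Graph.IsSpanningTree T D.seifertGraph → D.dPlus T = dp ∧ D.dMinus T = dm) ∧
      (1 / 2 : ℚ) * ((D.writhe : ℚ) + D.numCircles (fun _ => 1) - D.numCircles (fun _ => -1))
        = (dp : ℚ) - dm) ∧
    (∀ p : C, ¬ D.IsNugatory p →
      (1 / 2 : ℚ) * (((D.smooth p).writhe : ℚ) + (D.smooth p).numCircles (fun _ => 1)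
          - (D.smooth p).numCircles (fun _ => -1))
        = (1 / 2 : ℚ) *
          ((D.writhe : ℚ) + D.numCircles (fun _ => 1) - D.numCircles (fun _ => -1))) := by
  obtain ⟨T, hT⟩ := hconn.exists_isSpanningTree D.seifertState
  have hkey := D.dPlus_sub_dMinus hplanar hconn halt hT
  refine ⟨⟨T, hT⟩, ⟨D.dPlus T, D.dMinus T, fun T' hT' => ?_, ?_⟩, fun p hp => ?_⟩
  -- Both the sum and the difference of `dPlus` and `dMinus` are independent of the tree.
  · have hkey' := D.dPlus_sub_dMinus hplanar hconn halt hT'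
    have h := D.dPlus_add_dMinus hT
    have h' := D.dPlus_add_dMinus hT'
    omega
  · have hQ := congrArg (Int.cast : ℤ → ℚ) hkey
    push_cast at hQ
    rw [hQ]
    ring
  · have hQ := congrArg (Int.cast : ℤ → ℚ) (D.smooth_invariant hplanar hconn halt hp)
    push_cast at hQ
    rw [hQ]
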